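/- Let $j=e^{2\pi i/3}$, $F=\mathbb{Q}(j)$, $\theta=2\cos(\pi/14)=\zeta_{28}+\zeta_{28}^{-1}$ with $\zeta_{28}=e^{2\pi i/28}$, and $K=\mathbb{Q}(j,\theta)\subset\mathbb{C}$. Then $K/F$ is a cyclic Galois extension of degree $6$, and none of the elements $j$, $-j$, $j^2$, $-j^2$, $-1$ of $F$ is of the form $N_{K/F}(x)$ with $x\in K$. Hence, for every generator $\sigma$ of $\mathrm{Gal}(K/F)$, the cyclic algebra $\mathcal{A}=(K/F,\sigma,-j)$ is a division algebra, that is, $\mathcal{A}\neq 0$ and every nonzero element of $\mathcal{A}$ is invertible. Here $$(K/F,\sigma,\gamma)=1\cdot K\oplus e\cdot K\oplus\cdots\oplus e^{5}\cdot K,\qquad e^{6}=\gamma,\qquad l\,e=e\,\sigma(l)\ \text{ for all } l\in K .$$ -/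

import Mathlib

open scoped IntermediateField

noncomputable section CyclicAlgebra

set_option linter.unusedSectionVars false

variable {F K : Type*} [Field F] [Field K] [Algebra F K] [FiniteDimensional F K]

/-- Coordinates of the cyclic algebra `(K/F, σ, γ) = 1·K ⊕ e·K ⊕ ⋯ ⊕ e^(n-1)·K`, where `n` is the
order of `σ`: the function `x` stands for `∑ i, e^i · x i`. Here `σ` is meant to be a generator of
`Gal(K/F)` (so `n = [K : F]`) and `γ` to be nonzero. -/
def CyclicAlgebra (σ : K ≃ₐ[F] K) (_γ : F) : Type _ := Fin (orderOf σ) → K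

namespace CyclicAlgebra

instance (σ : K ≃ₐ[F] K) : NeZero (orderOf σ) := ⟨(orderOf_pos σ).ne'⟩

variable (σ : K ≃ₐ[F] K) (γ : F)

instance : AddCommGroup (CyclicAlgebra σ γ) :=
  inferInstanceAs (AddCommGroup (Fin (orderOf σ) → K))

instance : Module F (CyclicAlgebra σ γ) :=
  inferInstanceAs (Module F (Fin (orderOf σ) → K))

variable {σ γ}

/-- The matrix of left multiplication by `x = ∑ i, e^i · x i` in the basis `1, e, …, e^(n-1)` of
the right `K`-vector space `(K/F, σ, γ)`. The index `k - j` is taken modulo `n`; the entry in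
row `k` and column `j` is `σ^j (x (k - j))`, multiplied by `γ` above the diagonal. -/
def toMatrix (x : CyclicAlgebra σ γ) : Matrix (Fin (orderOf σ)) (Fin (orderOf σ)) K :=
  fun k j => (if j ≤ k then 1 else algebraMap F K γ) * (σ ^ (j : ℕ)) (x (k - j))

/-- Multiplication determined by `l e = e σ(l)` for `l ∈ K` and `e ^ n = γ`, that is, by
`(e^i · a) (e^j · b) = e^(i+j) · σ^j(a) b`. -/
instance : Mul (CyclicAlgebra σ γ) := ⟨fun x y => (toMatrix x).mulVec y⟩

/-- The embedding of `K` onto the summand `1·K`. -/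
def ofField (σ : K ≃ₐ[F] K) (γ : F) (a : K) : CyclicAlgebra σ γ := fun i => if i = 0 then a else 0

instance : One (CyclicAlgebra σ γ) := ⟨ofField σ γ 1⟩

/-- The basis vector `e^i`, for `0 ≤ i < n`. -/
def basisVec (σ : K ≃ₐ[F] K) (γ : F) (i : Fin (orderOf σ)) : CyclicAlgebra σ γ :=
  fun k => if k = i then 1 else 0

/-- The element `e` of `(K/F, σ, γ)`; in degree one, where `1·K` is the only summand, it is `γ`. -/
def gen (σ : K ≃ₐ[F] K) (γ : F) : CyclicAlgebra σ γ :=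
  if h : 1 < orderOf σ then basisVec σ γ ⟨1, h⟩ else ofField σ γ (algebraMap F K γ)

theorem mul_def (x y : CyclicAlgebra σ γ) : x * y = (toMatrix x).mulVec y := rfl

theorem mul_apply (x y : CyclicAlgebra σ γ) (k : Fin (orderOf σ)) :
    (x * y) k = ∑ j, (if j ≤ k then 1 else algebraMap F K γ) *
      (σ ^ (j : ℕ)) (x (k - j)) * y j := rfl

theorem add_apply (x y : CyclicAlgebra σ γ) (k : Fin (orderOf σ)) : (x + y) k = x k + y k := rfl

theorem smul_apply (a : F) (x : CyclicAlgebra σ γ) (k : Fin (orderOf σ)) :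
    (a • x) k = a • x k := rfl

theorem pow_add_val (σ : K ≃ₐ[F] K) (i j : Fin (orderOf σ)) (a : K) :
    (σ ^ ((i + j : Fin (orderOf σ)) : ℕ)) a = (σ ^ (j : ℕ)) ((σ ^ (i : ℕ)) a) := by
  rw [Fin.val_add, pow_mod_orderOf, add_comm, pow_add, AlgEquiv.mul_apply]

theorem factor_mul {n : ℕ} [NeZero n] (c : K) (k i j : Fin n) :
    (if j ≤ k then 1 else c) * (if i ≤ k - j then 1 else c) =
      (if i + j ≤ k then 1 else c) * (if j ≤ i + j then 1 else c) := by
  have hi := i.isLt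
  have hj := j.isLt
  have hk := k.isLt
  have h1 : ((i + j : Fin n) : ℕ) = if i.val + j.val < n then i.val + j.val
      else i.val + j.val - n := by
    rw [Fin.val_add]
    split_ifs with h
    · exact Nat.mod_eq_of_lt h
    · rw [Nat.mod_eq_sub_mod (by omega), Nat.mod_eq_of_lt (by omega)]
  have h2 : ((k - j : Fin n) : ℕ) = if j.val ≤ k.val then k.val - j.val
      else n + k.val - j.val := by
    rw [Fin.val_sub]
    split_ifs with h
    · rw [Nat.mod_eq_sub_mod (by omega), Nat.mod_eq_of_lt (by omega)]
      omega
    · rw [Nat.mod_eq_of_lt (by omega)]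
      omega
  simp only [Fin.le_def, h1, h2]
  split_ifs <;> first | omega | simp

theorem toMatrix_mul (x y : CyclicAlgebra σ γ) : toMatrix (x * y) = toMatrix x * toMatrix y := by
  ext k j
  rw [Matrix.mul_apply]
  simp only [toMatrix, mul_apply, map_sum, map_mul, Finset.mul_sum]
  refine Fintype.sum_equiv (Equiv.addRight j) _ _ fun i => ?_
  have h0 : (σ ^ (j : ℕ)) (if i ≤ k - j then 1 else algebraMap F K γ) =
      if i ≤ k - j then 1 else algebraMap F K γ := by
    split_ifs <;> simp
  have h1 : k - (i + j) = k - j - i := by abel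
  have h2 := factor_mul (algebraMap F K γ) k i j
  rw [show (Equiv.addRight j) i = i + j from rfl, h0, h1, pow_add_val, add_sub_cancel_right]
  linear_combination (σ ^ (j : ℕ)) ((σ ^ (i : ℕ)) (x (k - j - i))) * (σ ^ (j : ℕ)) (y i) * h2

theorem toMatrix_ofField (a : K) :
    toMatrix (ofField σ γ a) = Matrix.diagonal fun j : Fin (orderOf σ) => (σ ^ (j : ℕ)) a := by
  ext k j
  by_cases h : k = j
  · subst h
    simp [toMatrix, ofField]
  · simp [toMatrix, ofField, sub_eq_zero, h]

theorem toMatrix_one : toMatrix (1 : CyclicAlgebra σ γ) = 1 := by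
  rw [show (1 : CyclicAlgebra σ γ) = ofField σ γ 1 from rfl, toMatrix_ofField]
  simp

theorem toMatrix_add (x y : CyclicAlgebra σ γ) : toMatrix (x + y) = toMatrix x + toMatrix y := by
  ext k j
  simp [toMatrix, add_apply, mul_add]

theorem mul_one' (x : CyclicAlgebra σ γ) : x * 1 = x := by
  funext k
  rw [mul_apply, Finset.sum_eq_single 0]
  · simp [show (1 : CyclicAlgebra σ γ) = ofField σ γ 1 from rfl, ofField]
  · intro j _ hj
    simp [show (1 : CyclicAlgebra σ γ) = ofField σ γ 1 from rfl, ofField, hj]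
  · simp

instance : Ring (CyclicAlgebra σ γ) :=
  { (inferInstance : AddCommGroup (CyclicAlgebra σ γ)),
    (inferInstance : Mul (CyclicAlgebra σ γ)),
    (inferInstance : One (CyclicAlgebra σ γ)) with
    mul_assoc := fun x y z => by
      rw [mul_def (x * y), toMatrix_mul]
      exact (Matrix.mulVec_mulVec z (toMatrix x) (toMatrix y)).symm
    one_mul := fun x => by
      rw [mul_def, toMatrix_one]
      exact Matrix.one_mulVec _
    mul_one := mul_one'
    left_distrib := fun x y z => Matrix.mulVec_add (toMatrix x) y z
    right_distrib := fun x y z => by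
      rw [mul_def, toMatrix_add]
      exact Matrix.add_mulVec _ _ _
    zero_mul := fun x => by
      funext k
      rw [mul_apply]
      refine Finset.sum_eq_zero fun j _ => ?_
      rw [show (0 : CyclicAlgebra σ γ) (k - j) = 0 from rfl]
      simp
    mul_zero := fun x => Matrix.mulVec_zero (toMatrix x) }

instance : Algebra F (CyclicAlgebra σ γ) :=
  Algebra.ofModule
    (fun a x y => by
      funext k
      simp only [mul_apply, smul_apply, Finset.smul_sum, map_smul]
      exact Finset.sum_congr rfl fun j _ => by simp only [Algebra.smul_def]; ring)
    (fun a x y => by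
      funext k
      simp only [mul_apply, smul_apply, Finset.smul_sum]
      exact Finset.sum_congr rfl fun j _ => by simp only [Algebra.smul_def]; ring)

theorem ofField_mul_apply (a : K) (x : CyclicAlgebra σ γ) (k : Fin (orderOf σ)) :
    (ofField σ γ a * x) k = (σ ^ (k : ℕ)) a * x k := by
  rw [mul_def, toMatrix_ofField]
  exact Matrix.mulVec_diagonal _ _ _

theorem basisVec_mul_apply (i : Fin (orderOf σ)) (x : CyclicAlgebra σ γ) (k : Fin (orderOf σ)) :
    (basisVec σ γ i * x) k = (if k - i ≤ k then 1 else algebraMap F K γ) * x (k - i) := by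
  rw [mul_apply, Finset.sum_eq_single (k - i)]
  · simp [basisVec]
  · intro j _ hj
    have : k - j ≠ i := fun h => hj (by rw [← h]; abel)
    simp [basisVec, this]
  · simp

theorem basisVec_mul_ofField (i : Fin (orderOf σ)) (a : K) (k : Fin (orderOf σ)) :
    (basisVec σ γ i * ofField σ γ a) k = if k = i then a else 0 := by
  rw [basisVec_mul_apply]
  by_cases h : k = i
  · subst h
    simp [ofField]
  · simp [ofField, sub_eq_zero, h]

/-- `K` is a subalgebra of `(K/F, σ, γ)`. -/
def ofFieldHom (σ : K ≃ₐ[F] K) (γ : F) : K →ₐ[F] CyclicAlgebra σ γ where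
  toFun := ofField σ γ
  map_one' := rfl
  map_mul' a b := by
    funext k
    rw [ofField_mul_apply]
    by_cases h : k = 0 <;> simp [ofField, h]
  map_zero' := by
    funext k
    simp only [ofField, ite_self]
    rfl
  map_add' a b := by
    funext k
    rw [add_apply]
    by_cases h : k = 0 <;> simp [ofField, h]
  commutes' c := by
    rw [Algebra.algebraMap_eq_smul_one c, Algebra.algebraMap_eq_smul_one c]
    funext k
    change (if k = 0 then c • (1 : K) else 0) = c • (if k = 0 then (1 : K) else 0)
    rw [smul_ite, smul_zero]

theorem gen_pow_eq_basisVec (m : ℕ) (hm : m < orderOf σ) :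
    gen σ γ ^ m = basisVec σ γ ⟨m, hm⟩ := by
  induction m with
  | zero => rw [pow_zero]; rfl
  | succ m ih =>
    have h1 : 1 < orderOf σ := by omega
    rw [pow_succ', ih (by omega), gen, dif_pos h1]
    funext k
    rw [basisVec_mul_apply]
    have hk := k.isLt
    have hv : ((k - ⟨1, h1⟩ : Fin (orderOf σ)) : ℕ) = if 1 ≤ k.val then k.val - 1
        else orderOf σ - 1 := by
      rw [Fin.val_sub]
      split_ifs with h
      · rw [Nat.mod_eq_sub_mod (by dsimp only; omega), Nat.mod_eq_of_lt (by dsimp only; omega)]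
        dsimp only; omega
      · rw [Nat.mod_eq_of_lt (by dsimp only; omega)]
        dsimp only; omega
    simp only [basisVec, Fin.le_def, Fin.ext_iff, hv]
    split_ifs <;> first | omega | simp

/-- The defining relation `e ^ n = γ`. -/
theorem gen_pow_orderOf : gen σ γ ^ orderOf σ = algebraMap F (CyclicAlgebra σ γ) γ := by
  have h0 := orderOf_pos σ
  rw [← (ofFieldHom σ γ).commutes γ]
  change _ = ofField σ γ (algebraMap F K γ)
  by_cases h1 : 1 < orderOf σ
  · obtain ⟨m, hm⟩ : ∃ m, orderOf σ = m + 1 := ⟨orderOf σ - 1, by omega⟩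
    have h : gen σ γ ^ orderOf σ = gen σ γ * gen σ γ ^ m := by rw [← pow_succ', hm]
    rw [h, gen_pow_eq_basisVec m (by omega), gen, dif_pos h1]
    funext k
    rw [basisVec_mul_apply]
    have hk := k.isLt
    have hv : ((k - ⟨1, h1⟩ : Fin (orderOf σ)) : ℕ) = if 1 ≤ k.val then k.val - 1
        else orderOf σ - 1 := by
      rw [Fin.val_sub]
      split_ifs with h
      · rw [Nat.mod_eq_sub_mod (by dsimp only; omega), Nat.mod_eq_of_lt (by dsimp only; omega)]
        dsimp only; omega
      · rw [Nat.mod_eq_of_lt (by dsimp only; omega)]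
        dsimp only; omega
    simp only [basisVec, ofField, Fin.le_def, Fin.ext_iff, hv, Fin.val_zero]
    split_ifs <;> first | omega | simp
  · have h2 : orderOf σ = 1 := by omega
    have h : gen σ γ ^ orderOf σ = gen σ γ ^ 1 := by rw [h2]
    rw [h, pow_one, gen, dif_neg h1]

/-- The defining relation `l e = e σ(l)` for `l ∈ K`. -/
theorem ofField_mul_gen (l : K) :
    ofField σ γ l * gen σ γ = gen σ γ * ofField σ γ (σ l) := by
  by_cases h1 : 1 < orderOf σ
  · rw [gen, dif_pos h1]
    funext k
    rw [basisVec_mul_ofField, ofField_mul_apply]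
    by_cases hk : k = ⟨1, h1⟩
    · subst hk
      simp [basisVec]
    · simp [basisVec, hk]
  · have h0 := orderOf_pos σ
    have h2 : orderOf σ = 1 := by omega
    have h3 : σ = 1 := orderOf_eq_one_iff.mp h2
    have h4 : σ l = l := by rw [h3]; rfl
    rw [gen, dif_neg h1, h4]
    change ofFieldHom σ γ l * ofFieldHom σ γ _ = ofFieldHom σ γ _ * ofFieldHom σ γ l
    rw [← map_mul, ← map_mul, mul_comm]

/-- The decomposition `(K/F, σ, γ) = 1·K ⊕ e·K ⊕ ⋯ ⊕ e^(n-1)·K`: every `x` is uniquely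
`∑ i, e^i · c i` with `c i ∈ K`, and the `c i` are the coordinates of `x`. -/
theorem eq_sum_iff (x : CyclicAlgebra σ γ) (c : Fin (orderOf σ) → K) :
    x = ∑ i : Fin (orderOf σ), gen σ γ ^ (i : ℕ) * ofField σ γ (c i) ↔ c = x := by
  have key : ∑ i : Fin (orderOf σ), gen σ γ ^ (i : ℕ) * ofField σ γ (c i) =
      (id c : CyclicAlgebra σ γ) := by
    funext k
    let ev : CyclicAlgebra σ γ →+ K :=
      { toFun := fun y => y k, map_zero' := rfl, map_add' := fun _ _ => rfl }
    have h : ∀ i : Fin (orderOf σ), ev (gen σ γ ^ (i : ℕ) * ofField σ γ (c i)) =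
        if k = i then c i else 0 := fun i => by
      rw [gen_pow_eq_basisVec i i.isLt]
      exact basisVec_mul_ofField i (c i) k
    have h' := map_sum ev (fun i : Fin (orderOf σ) => gen σ γ ^ (i : ℕ) * ofField σ γ (c i))
      Finset.univ
    simp only [h, Finset.sum_ite_eq, Finset.mem_univ, if_true] at h'
    exact h'
  rw [key]
  exact eq_comm

end CyclicAlgebra

/-- Every nonzero element is invertible (and there is one). -/
def IsDivisionAlgebra (A : Type*) [Ring A] : Prop :=
  Nontrivial A ∧ ∀ a : A, a ≠ 0 → IsUnit a

end CyclicAlgebra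

noncomputable section Fields

/-- The primitive cube root of unity `j = e^(2πi/3)`. -/
def cubeRoot : ℂ := Complex.exp (2 * Real.pi * Complex.I / 3)

/-- The base field `F = ℚ(j)`. -/
abbrev BaseField : IntermediateField ℚ ℂ := ℚ⟮cubeRoot⟯

/-- `θ = 2 cos(π/14)`. -/
def theta : ℂ := ((2 * Real.cos (Real.pi / 14) : ℝ) : ℂ)

/-- `K = ℚ(j, θ)`, as the extension `F(θ)` of `F = ℚ(j)`. -/
abbrev ExtField : IntermediateField BaseField ℂ := BaseField⟮theta⟯

/-- `j` as an element of `F`. -/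
def jF : BaseField := IntermediateField.AdjoinSimple.gen ℚ cubeRoot

theorem coe_jF : (jF : ℂ) = cubeRoot := rfl

/-- As a subfield of `ℂ`, the field `K` is `ℚ(j, θ)`. -/
theorem restrictScalars_extField : ExtField.restrictScalars ℚ = ℚ⟮cubeRoot, theta⟯ :=
  IntermediateField.adjoin_simple_adjoin_simple ℚ cubeRoot theta

theorem theta_eq : theta = Complex.exp (2 * Real.pi * Complex.I / 28) +
    (Complex.exp (2 * Real.pi * Complex.I / 28))⁻¹ := by
  rw [theta, ← Complex.exp_neg]
  push_cast
  rw [Complex.two_cos]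
  congr 2 <;> ring

instance : FiniteDimensional BaseField ExtField := by
  apply IntermediateField.adjoin.finiteDimensional
  have h := (Real.isIntegral_two_mul_cos_rat_mul_pi (1 / 14)).map
    (algebraMap ℝ ℂ).toIntAlgHom
  have h2 : theta = (algebraMap ℝ ℂ).toIntAlgHom
      (2 * Real.cos (((1 / 14 : ℚ) : ℝ) * Real.pi)) := by
    change ((2 * Real.cos (Real.pi / 14) : ℝ) : ℂ) = ((_ : ℝ) : ℂ)
    congr 3
    push_cast
    ring
  rw [h2]
  exact h.tower_top

end Fields

/-!
The argument is local at the prime `7`, which splits in `F` and is totally and tamely ramified in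
`K / F`.

As `7 ≡ 1 mod 3`, any embedding of `K` into an algebraic closure of `ℚ_[7]` carries `F` into `ℚ_[7]`
(`exists_embedding`). The image of `θ` is a root of the Eisenstein polynomial
`X⁶ - 7X⁴ + 14X² - 7`, so it has valuation `1 / 6`, and the terms of a sum
`∑ k < 6, a k * θ ^ k` with `a k ∈ ℚ_[7]` have pairwise distinct valuations. Such a sum is therefore
integral exactly when all `a k` are (`norm_sum_mul_pow_le_one_iff`). This gives `[K : F] = 6`, and
it shows that the `7`-adic valuation ring `O` of `K` is stable under `Gal(K/F)`, which permutes the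
roots of the polynomial, and has residue field `𝔽₇` (`exists_valuationSubring`). In particular the
Galois group acts trivially on the residue field.

*Norms.* For a unit `x` of `O` the norm of `x` reduces to `x ^ 6 = 1` in `𝔽₇`. Reduction is
injective on sixth roots of unity, so `1` is the only sixth root of unity in `F` which is a norm
(`ValuationSubring.eq_one_of_norm_eq`).

*The cyclic algebra.* Reducing coordinates modulo the maximal ideal of `O` sends
`∑ e ^ i * x i` to `∑ (x i mod 𝔪) * α ^ i`, where `α ^ 6` is the reduction `g` of `-j`. This is
multiplicative, because `σ` acts trivially on residues. The element `g` generates `𝔽₇ˣ`, so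
`α ^ 7 = g α` with distinct powers `1, g, …, g ^ 5`, and Frobenius shows that `1, α, …, α ^ 5` are
linearly independent over `𝔽₇` (`eq_zero_of_sum_mul_pow_eq_zero`). After scaling by elements of `K`,
nonzero elements of the cyclic algebra have nonzero reduction; hence the algebra has no zero
divisors (`CyclicAlgebra.isDivisionAlgebra_of_residue`), and it is finite-dimensional over `F`.
-/

/-! ### Eisenstein elements over `ℚ_[p]` -/

instance fact_prime_seven : Fact (Nat.Prime 7) := ⟨by norm_num⟩

/-- If `β` has valuation `1 / e` over `ℚ_[p]`, the nonzero terms of `∑ k < e, a k * β ^ k` have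
pairwise distinct norms, so that each of them is bounded by the norm of the sum. -/
theorem norm_le_norm_sum_mul_pow {p e : ℕ} [Fact p.Prime] {L : Type*} [NormedField L]
    [IsUltrametricDist L] [NormedAlgebra ℚ_[p] L] {β : L} (hβ : ‖β‖ ^ e = (p : ℝ)⁻¹)
    (a : ℕ → ℚ_[p]) {i : ℕ} (hi : i < e) :
    ‖a i‖ * ‖β‖ ^ i ≤ ‖∑ k ∈ Finset.range e, algebraMap ℚ_[p] L (a k) * β ^ k‖ := by
  have hp : (1 : ℝ) < p := by exact_mod_cast (Fact.out : p.Prime).one_lt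
  have hp0 : (p : ℝ) ≠ 0 := by positivity
  have hβ0 : β ≠ 0 := by
    rintro rfl
    rw [norm_zero, zero_pow (by omega)] at hβ
    exact inv_ne_zero hp0 hβ.symm
  set f : ℕ → L := fun k => algebraMap ℚ_[p] L (a k) * β ^ k with hf
  have hnorm : ∀ k, ‖f k‖ = ‖a k‖ * ‖β‖ ^ k := fun k => by
    rw [hf]; simp only [norm_mul, norm_pow, norm_algebraMap']
  by_cases hai : a i = 0
  · rw [hai, norm_zero, zero_mul]; exact norm_nonneg _
  classical
  set s := (Finset.range e).filter fun k => a k ≠ 0 with hs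
  have his : i ∈ s := by simp [hs, hi, hai]
  have hsum : ∑ k ∈ Finset.range e, f k = ∑ k ∈ s, f k := by
    rw [hs, Finset.sum_filter]
    refine Finset.sum_congr rfl fun k _ => ?_
    split_ifs with h
    · rfl
    · rw [not_not] at h; simp [hf, h]
  -- The `e`-th power of the `k`-th norm is `p` to an exponent congruent to `-k` modulo `e`.
  have hpow : ∀ k, a k ≠ 0 → ‖f k‖ ^ e = (p : ℝ) ^ (-(e * (a k).valuation + k : ℤ)) := by
    intro k hk
    rw [hnorm, mul_pow, ← pow_mul, mul_comm k e, pow_mul, hβ,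
      Padic.norm_eq_zpow_neg_valuation hk, ← zpow_natCast, ← zpow_mul, inv_pow,
      ← zpow_natCast, ← zpow_neg, ← zpow_add₀ hp0]
    congr 1; ring
  have hne : Set.Pairwise (s : Set ℕ) (Function.onFun Ne fun k => ‖f k‖) := by
    intro k hk l hl hkl h
    simp only [hs, Finset.coe_filter, Finset.mem_range, Set.mem_ofPred_eq] at hk hl
    have h1 : ‖f k‖ ^ e = ‖f l‖ ^ e := congrArg (· ^ e) h
    rw [hpow k hk.2, hpow l hl.2] at h1
    have h2 := zpow_right_injective₀ (by positivity) hp.ne' h1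
    have h3 : (k : ℤ) ≡ l [ZMOD e] := by
      rw [Int.modEq_iff_dvd]
      exact ⟨(a k).valuation - (a l).valuation, by linarith⟩
    have h4 := (Int.natCast_modEq_iff.mp h3)
    exact hkl (Nat.ModEq.eq_of_lt_of_lt h4 hk.1 hl.1)
  rw [hsum, IsUltrametricDist.norm_sum_eq_sup'_of_pairwise_ne ⟨i, his⟩ hne, ← hnorm]
  exact Finset.le_sup' (fun k => ‖f k‖) his

/-- A power basis on an element of valuation `1 / e` is an integral basis. -/
theorem norm_sum_mul_pow_le_one_iff {p e : ℕ} [Fact p.Prime] {L : Type*} [NormedField L]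
    [IsUltrametricDist L] [NormedAlgebra ℚ_[p] L] {β : L} (hβ : ‖β‖ ^ e = (p : ℝ)⁻¹)
    (a : ℕ → ℚ_[p]) :
    ‖∑ k ∈ Finset.range e, algebraMap ℚ_[p] L (a k) * β ^ k‖ ≤ 1 ↔ ∀ k < e, ‖a k‖ ≤ 1 := by
  have hp : (1 : ℝ) < p := by exact_mod_cast (Fact.out : p.Prime).one_lt
  have hp0 : (p : ℝ) ≠ 0 := by positivity
  constructor
  · intro h k hk
    by_cases hak : a k = 0
    · simp [hak]
    have h1 := (norm_le_norm_sum_mul_pow hβ a hk).trans h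
    have h2 : (‖a k‖ * ‖β‖ ^ k) ^ e ≤ 1 := pow_le_one₀ (by positivity) h1
    rw [mul_pow, ← pow_mul, mul_comm k e, pow_mul, hβ,
      Padic.norm_eq_zpow_neg_valuation hak, ← zpow_natCast, ← zpow_mul, inv_pow,
      ← zpow_natCast, ← zpow_neg, ← zpow_add₀ hp0, zpow_le_one_iff_right₀ hp] at h2
    rw [Padic.norm_le_one_iff_val_nonneg]
    -- Here `e * v + k ≥ 0` for `v = (a k).valuation`, and `k < e` excludes `v ≤ -1`.
    by_contra hneg
    have h3 : (a k).valuation + 1 ≤ 0 := by omega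
    nlinarith
  · intro h
    have hβ1 : ‖β‖ ≤ 1 := by
      by_contra hβ1
      have h5 : 1 ≤ ‖β‖ ^ e := one_le_pow₀ (by linarith)
      rw [hβ] at h5
      exact absurd (inv_lt_one_of_one_lt₀ hp) (by linarith)
    refine IsUltrametricDist.norm_sum_le_of_forall_le_of_nonneg zero_le_one fun k hk => ?_
    rw [norm_mul, norm_pow, norm_algebraMap']
    exact mul_le_one₀ (h k (Finset.mem_range.mp hk)) (by positivity)
      (pow_le_one₀ (norm_nonneg _) hβ1)

/-- The roots of the Eisenstein polynomial `X⁶ - 7X⁴ + 14X² - 7` have valuation `1 / 6`: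
of its terms, only `X⁶` and `7` can have the largest norm at a root. -/
theorem norm_pow_six_of_root {L : Type*} [NormedField L]
    [IsUltrametricDist L] [NormedAlgebra ℚ_[7] L] {β : L}
    (hβ : β ^ 6 - 7 * β ^ 4 + 14 * β ^ 2 - 7 = 0) : ‖β‖ ^ 6 = ((7 : ℕ) : ℝ)⁻¹ := by
  have h7 : ‖(7 : L)‖ = 7⁻¹ := by
    have h := norm_algebraMap' L (7 : ℚ_[7])
    rw [map_ofNat] at h
    rw [h]
    simpa using Padic.norm_p (p := 7)
  have h2 : ‖(2 : L)‖ ≤ 1 := by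
    simpa using IsUltrametricDist.norm_natCast_le_one L 2
  have h14 : ∀ u : L, ‖7 * (β ^ 4 - 2 * u)‖ ≤ 7⁻¹ * max (‖β‖ ^ 4) ‖u‖ := fun u => by
    rw [norm_mul, h7]
    refine mul_le_mul_of_nonneg_left ?_ (by norm_num)
    rw [sub_eq_add_neg]
    refine (IsUltrametricDist.norm_add_le_max _ _).trans (max_le_max (norm_pow _ _).le ?_)
    rw [norm_neg, norm_mul]
    exact mul_le_of_le_one_left (norm_nonneg _) h2
  have hb0 := norm_nonneg β
  have hlt : ‖β‖ < 1 := by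
    by_contra hge
    have hge : 1 ≤ ‖β‖ := not_lt.mp hge
    have h1 : β ^ 6 = 7 * (β ^ 4 - 2 * β ^ 2) + 7 := by linear_combination hβ
    have h3 : ‖β‖ ^ 6 ≤ 7⁻¹ * ‖β‖ ^ 6 := by
      rw [← norm_pow β 6]
      conv_lhs => rw [h1]
      rw [norm_pow]
      refine (IsUltrametricDist.norm_add_le_max _ _).trans (max_le ?_ ?_)
      · refine (h14 _).trans (mul_le_mul_of_nonneg_left (max_le ?_ ?_) (by norm_num))
        · exact pow_le_pow_right₀ hge (by norm_num)
        · rw [norm_pow]; exact pow_le_pow_right₀ hge (by norm_num)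
      · rw [h7]
        have := one_le_pow₀ hge (n := 6)
        linarith
    have := one_le_pow₀ hge (n := 6)
    linarith
  have h1 : β ^ 6 = 7 + 7 * (β ^ 4 - 2 * β ^ 2) := by linear_combination hβ
  have hsmall : ‖7 * (β ^ 4 - 2 * β ^ 2)‖ < ‖(7 : L)‖ := by
    rw [h7]
    refine (h14 _).trans_lt (mul_lt_of_lt_one_right (by norm_num) (max_lt ?_ ?_))
    · exact pow_lt_one₀ hb0 hlt (by norm_num)
    · rw [norm_pow]; exact pow_lt_one₀ hb0 hlt (by norm_num)
  rw [← norm_pow, h1, IsUltrametricDist.norm_add_eq_max_of_norm_ne_norm hsmall.ne',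
    max_eq_left hsmall.le, h7]
  norm_num

/-- Hensel's lemma lifts the root `2` of `X ^ 2 + X + 1` modulo `7`. -/
theorem exists_padic_root_cyclotomic_three : ∃ z : ℚ_[7], z ^ 2 + z + 1 = 0 := by
  have h := hensels_lemma (p := 7) (F := (Polynomial.X ^ 2 + Polynomial.X + 1 : Polynomial ℤ_[7]))
    (a := 2) (by
      have h5 : ‖((5 : ℤ) : ℤ_[7])‖ = 1 := by
        rw [PadicInt.norm_intCast_eq_one_iff]; decide
      have h7 : ‖((7 : ℕ) : ℤ_[7])‖ < 1 := by
        rw [PadicInt.norm_p]; norm_num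
      have e1 : Polynomial.aeval (2 : ℤ_[7])
        (Polynomial.X ^ 2 + Polynomial.X + 1 : Polynomial ℤ_[7]) = ((7 : ℕ) : ℤ_[7]) := by
        simp; norm_num
      have e2 : Polynomial.aeval (2 : ℤ_[7]) (Polynomial.derivative
        (Polynomial.X ^ 2 + Polynomial.X + 1 : Polynomial ℤ_[7])) = ((5 : ℤ) : ℤ_[7]) := by
        simp; norm_num
      rw [e1, e2, h5]
      simpa using h7)
  obtain ⟨z, hz, -⟩ := h
  refine ⟨z, ?_⟩
  simp only [map_add, map_pow, Polynomial.aeval_X, map_one] at hz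
  exact_mod_cast congrArg (fun t : ℤ_[7] => (t : ℚ_[7])) hz

/-! ### Division criterion for cyclic algebras -/

/-- Let `α` be an `n`-th root of a generator `g` of `𝔽ₚˣ`, where `p = n + 1`. Then
`1, α, …, α ^ (n - 1)` are linearly independent over `𝔽ₚ`, the set of solutions of `c ^ p = c`.
Indeed `α ^ p = g * α`, so applying Frobenius `k` times to a relation between them multiplies its
`i`-th term by `g ^ (k * i)`, and the Vandermonde matrix of the powers of `g` is invertible. -/
theorem eq_zero_of_sum_mul_pow_eq_zero {E : Type*} [Field E] {n : ℕ} [hn : Fact (n + 1).Prime]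
    [CharP E (n + 1)] {α g : E} (hα : α ^ n = g) (hg : IsPrimitiveRoot g n) {c : Fin n → E}
    (hc : ∀ i, c i ^ (n + 1) = c i) (h : ∑ i, c i * α ^ (i : ℕ) = 0) (i : Fin n) : c i = 0 := by
  have hn0 : n ≠ 0 := by rintro rfl; exact Nat.not_prime_one hn.out
  have hα0 : α ≠ 0 := by
    rintro rfl
    rw [zero_pow hn0] at hα
    exact hg.ne_zero hn0 hα.symm
  have key : ∀ k : ℕ, ∑ i : Fin n, (g ^ k) ^ (i : ℕ) * (c i * α ^ (i : ℕ)) = 0 := by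
    intro k
    induction k with
    | zero => simpa using h
    | succ k ih =>
      have h1 := congrArg (· ^ (n + 1)) ih
      simp only [sum_pow_char (n + 1), zero_pow (Nat.succ_ne_zero n)] at h1
      rw [← h1]
      refine Finset.sum_congr rfl fun i _ => ?_
      have h2 : α ^ (n + 1) = g * α := by rw [pow_succ, hα]
      have h3 : g ^ (n + 1) = g := by rw [pow_succ, hg.pow_eq_one, one_mul]
      calc (g ^ (k + 1)) ^ (i : ℕ) * (c i * α ^ (i : ℕ))
          = (g ^ k) ^ (i : ℕ) * (c i * (g * α) ^ (i : ℕ)) := by ring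
        _ = ((g ^ (n + 1)) ^ k) ^ (i : ℕ) * (c i ^ (n + 1) * (α ^ (n + 1)) ^ (i : ℕ)) := by
            rw [h2, h3, hc]
        _ = _ := by ring
  have hinj : Function.Injective fun k : Fin n => g ^ (k : ℕ) := fun k l hkl =>
    Fin.ext (hg.pow_inj k.isLt l.isLt hkl)
  have hv := Matrix.eq_zero_of_forall_index_sum_pow_mul_eq_zero hinj fun k : Fin n => key k
  exact (mul_eq_zero.mp (congrFun hv i)).resolve_right (pow_ne_zero _ hα0)

/-- Dividing by a coordinate of the largest valuation makes a nonzero vector primitive. -/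
theorem ValuationSubring.exists_mul_eq_coe_and_eq_one {K ι : Type*} [Field K] [Fintype ι]
    (O : ValuationSubring K) {x : ι → K} (hx : x ≠ 0) :
    ∃ t : K, t ≠ 0 ∧ ∃ c : ι → O, (∀ i, x i * t = c i) ∧ ∃ i, c i = 1 := by
  obtain ⟨i₀, hi₀⟩ := Function.ne_iff.mp hx
  obtain ⟨m, -, hm⟩ := Finset.exists_max_image Finset.univ (fun i => O.valuation (x i))
    ⟨i₀, Finset.mem_univ _⟩
  have hxm : x m ≠ 0 := by
    intro h0
    have h1 := hm i₀ (Finset.mem_univ _)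
    rw [h0, map_zero, le_zero_iff, map_eq_zero] at h1
    exact hi₀ h1
  have hv : 0 < O.valuation (x m) := by
    rw [zero_lt_iff]; exact (map_ne_zero _).mpr hxm
  have hmem : ∀ i, x i * (x m)⁻¹ ∈ O := fun i => by
    rw [← O.valuation_le_one_iff, map_mul, map_inv₀, ← div_eq_mul_inv, div_le_one₀ hv]
    exact hm i (Finset.mem_univ _)
  exact ⟨(x m)⁻¹, inv_ne_zero hxm, fun i => ⟨_, hmem i⟩, fun _ => rfl, m,
    Subtype.ext (mul_inv_cancel₀ hxm)⟩

namespace CyclicAlgebra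

variable {F K E : Type*} [Field F] [Field K] [Algebra F K] [FiniteDimensional F K] [Field E]
  {σ : K ≃ₐ[F] K} {γ : F}

instance : FiniteDimensional F (CyclicAlgebra σ γ) :=
  inferInstanceAs (FiniteDimensional F (Fin (orderOf σ) → K))

theorem mul_ofField_apply (x : CyclicAlgebra σ γ) (t : K) (k : Fin (orderOf σ)) :
    (x * ofField σ γ t) k = x k * t := by
  rw [mul_apply, Finset.sum_eq_single 0]
  · simp [ofField]
  · intro j _ hj
    simp [ofField, hj]
  · simp

/-- If `σ` acts trivially on residues, then `∑ e ^ i * a i ↦ ∑ ρ (a i) * α ^ i` is multiplicative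
on elements with integral coordinates; this is the case in which the product vanishes. -/
theorem sum_residue_mul_eq_zero (O : ValuationSubring K) (hσ : ∀ x ∈ O, σ x ∈ O)
    (hγ : algebraMap F K γ ∈ O) (ρ : O →+* E)
    (hρ : ∀ (x : K) (hx : x ∈ O), ρ ⟨σ x, hσ x hx⟩ = ρ ⟨x, hx⟩)
    {α : E} (hα : α ^ orderOf σ = ρ ⟨algebraMap F K γ, hγ⟩) {x y : CyclicAlgebra σ γ}
    {a b : Fin (orderOf σ) → O} (ha : ∀ i, x i = a i) (hb : ∀ i, y i = b i) (hxy : x * y = 0) :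
    (∑ i, ρ (a i) * α ^ (i : ℕ)) * ∑ j, ρ (b j) * α ^ (j : ℕ) = 0 := by
  have hpow : ∀ (m : ℕ) (z : O), ∃ h : (σ ^ m) z ∈ O, ρ ⟨(σ ^ m) z, h⟩ = ρ z := by
    intro m z
    induction m with
    | zero => exact ⟨z.2, rfl⟩
    | succ m ih =>
      obtain ⟨h, h'⟩ := ih
      have e : (σ ^ (m + 1)) (z : K) = σ ((σ ^ m) z) := by rw [pow_succ', AlgEquiv.mul_apply]
      refine ⟨e ▸ hσ _ h, ?_⟩
      rw [← h', ← hρ _ h]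
      simp only [e]
  choose hmem hres using hpow
  have hcoord : ∀ k, ∑ j, (if j ≤ k then 1 else α ^ orderOf σ) * ρ (a (k - j)) * ρ (b j) = 0 := by
    intro k
    have h1 : (∑ j, (if j ≤ k then 1 else ⟨algebraMap F K γ, hγ⟩) *
        ⟨(σ ^ (j : ℕ)) (a (k - j)), hmem _ _⟩ * b j : O) = 0 := by
      apply Subtype.ext
      have h2 : (x * y) k = 0 := by rw [hxy]; rfl
      rw [mul_apply] at h2
      push_cast
      rw [← h2]
      refine Finset.sum_congr rfl fun j _ => ?_
      rw [ha, hb]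
      split_ifs <;> rfl
    have h3 := congrArg ρ h1
    simp only [map_sum, map_mul, hres, map_zero] at h3
    rw [← h3]
    refine Finset.sum_congr rfl fun j _ => ?_
    split_ifs <;> simp [hα]
  -- Collect the terms by `k = i + j` modulo `n`; the wrap-around contributes the factor `α ^ n`.
  rw [Finset.sum_mul_sum, Finset.sum_comm]
  calc ∑ j, ∑ i, ρ (a i) * α ^ (i : ℕ) * (ρ (b j) * α ^ (j : ℕ))
      = ∑ j, ∑ k, (if j ≤ k then 1 else α ^ orderOf σ) * ρ (a (k - j)) * ρ (b j) *
          α ^ (k : ℕ) := by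
        refine Finset.sum_congr rfl fun j _ => ?_
        refine Fintype.sum_equiv (Equiv.addRight j) _ _ fun i => ?_
        have h1 : (α : E) ^ (i : ℕ) * α ^ (j : ℕ) =
            (if j ≤ i + j then 1 else α ^ orderOf σ) * α ^ ((i + j : Fin (orderOf σ)) : ℕ) := by
          rw [← pow_add]
          have hi := i.isLt
          have hj := j.isLt
          have hv : ((i + j : Fin (orderOf σ)) : ℕ) = if i.val + j.val < orderOf σ then
              i.val + j.val else i.val + j.val - orderOf σ := by
            rw [Fin.val_add]
            split_ifs with h
            · exact Nat.mod_eq_of_lt h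
            · rw [Nat.mod_eq_sub_mod (by omega), Nat.mod_eq_of_lt (by omega)]
          simp only [Fin.le_def, hv]
          split_ifs <;> first | omega | simp [← pow_add]
          congr 1; omega
        rw [show (Equiv.addRight j) i = i + j from rfl, add_sub_cancel_right]
        linear_combination ρ (a i) * ρ (b j) * h1
    _ = ∑ k : Fin (orderOf σ), (∑ j, (if j ≤ k then 1 else α ^ orderOf σ) * ρ (a (k - j)) *
          ρ (b j)) * α ^ (k : ℕ) := by
        rw [Finset.sum_comm]
        simp only [Finset.sum_mul]
    _ = 0 := by simp only [hcoord, zero_mul, Finset.sum_const_zero]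

/-- A cyclic algebra is a division algebra if `σ` stabilizes a valuation ring and acts trivially on
its residues, and some `n`-th root `α` of the residue of `γ` has `1, α, …, α ^ (n - 1)` linearly
independent over the residues. -/
theorem isDivisionAlgebra_of_residue (O : ValuationSubring K) (hσ : ∀ x ∈ O, σ x ∈ O)
    (hγ : algebraMap F K γ ∈ O) (ρ : O →+* E)
    (hρ : ∀ (x : K) (hx : x ∈ O), ρ ⟨σ x, hσ x hx⟩ = ρ ⟨x, hx⟩)
    {α : E} (hα : α ^ orderOf σ = ρ ⟨algebraMap F K γ, hγ⟩)
    (hind : ∀ c : Fin (orderOf σ) → O, ∑ i, ρ (c i) * α ^ (i : ℕ) = 0 → ∀ i, ρ (c i) = 0) :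
    IsDivisionAlgebra (CyclicAlgebra σ γ) := by
  have hunit : ∀ t : K, t ≠ 0 → ofField σ γ t * ofField σ γ t⁻¹ = 1 := fun t ht => by
    have h := map_mul (ofFieldHom σ γ) t t⁻¹
    rw [mul_inv_cancel₀ ht, map_one] at h
    exact h.symm
  have hind' : ∀ c : Fin (orderOf σ) → O, (∃ i, c i = 1) → ∑ i, ρ (c i) * α ^ (i : ℕ) ≠ 0 := by
    rintro c ⟨i, hi⟩ h
    have := hind c h i
    rw [hi, map_one] at this
    exact one_ne_zero this
  have hdom : ∀ x y : CyclicAlgebra σ γ, x * y = 0 → x = 0 ∨ y = 0 := by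
    intro x y hxy
    by_contra! hne
    obtain ⟨t, ht, a, ha, ha1⟩ := O.exists_mul_eq_coe_and_eq_one (x := x) hne.1
    have hy : ofField σ γ t⁻¹ * y ≠ 0 := by
      intro h
      apply hne.2
      rw [← one_mul y, ← hunit t ht, mul_assoc, h, mul_zero]
    obtain ⟨s, hs, b, hb, hb1⟩ := O.exists_mul_eq_coe_and_eq_one
      (x := (ofField σ γ t⁻¹ * y : CyclicAlgebra σ γ)) hy
    have h := sum_residue_mul_eq_zero O hσ hγ ρ hρ hα (x := x * ofField σ γ t)
      (y := ofField σ γ t⁻¹ * y * ofField σ γ s) (a := a) (b := b)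
      (fun i => by rw [mul_ofField_apply, ha]) (fun i => by rw [mul_ofField_apply, hb]) (by
        rw [← mul_assoc, ← mul_assoc, mul_assoc x, hunit t ht, mul_one, hxy, zero_mul])
    exact (mul_eq_zero.mp h).elim (hind' a ha1) (hind' b hb1)
  refine ⟨⟨⟨1, 0, fun h => ?_⟩⟩, fun x hx => ?_⟩
  · have h0 : (1 : CyclicAlgebra σ γ) 0 = (0 : CyclicAlgebra σ γ) 0 := by rw [h]
    have h1 : (1 : CyclicAlgebra σ γ) 0 = 1 := by
      change (if (0 : Fin (orderOf σ)) = 0 then (1 : K) else 0) = 1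
      exact if_pos rfl
    exact one_ne_zero (α := K) (h1.symm.trans h0)
  · -- Left multiplication by `x` is injective, hence surjective in finite dimension.
    have hinj : Function.Injective (LinearMap.mulLeft F x) := by
      rw [← LinearMap.ker_eq_bot, LinearMap.ker_eq_bot']
      exact fun y hy => (hdom x y hy).resolve_left hx
    obtain ⟨y, hy⟩ := LinearMap.injective_iff_surjective.mp hinj 1
    rw [LinearMap.mulLeft_apply] at hy
    have hyx : y * x - 1 = 0 := (hdom x _ (by
      rw [mul_sub, ← mul_assoc, hy, one_mul, mul_one, sub_self])).resolve_left hx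
    exact ⟨⟨x, y, hy, sub_eq_zero.mp hyx⟩, rfl⟩

end CyclicAlgebra

/-! ### Galois-stable valuation rings with prime residue field -/

namespace ValuationSubring

variable {F K : Type*} [Field F] [Field K] [Algebra F K] {O : ValuationSubring K}

theorem mem_of_pow_eq_one {n : ℕ} (hn : n ≠ 0) {v : K} (hv : v ^ n = 1) : v ∈ O := by
  rw [← O.valuation_le_one_iff]
  refine (pow_le_one_iff hn).mp ?_
  rw [← map_pow, hv, map_one]

/-- Reduction is injective on `n`-th roots of unity when `n` is prime to the residue
characteristic, here `n + 1`. -/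
theorem eq_one_of_pow_eq_one_of_residue_eq_one {n : ℕ}
    [CharP (IsLocalRing.ResidueField O) (n + 1)] {v : O} (hv : v ^ n = 1)
    (h : IsLocalRing.residue O v = 1) : v = 1 := by
  by_contra hne
  have h0 : ∑ i ∈ Finset.range n, v ^ i = 0 := by
    have h1 := mul_geom_sum v n
    rw [hv, sub_self] at h1
    exact (mul_eq_zero.mp h1).resolve_left (sub_ne_zero.mpr hne)
  have h2 := congrArg (IsLocalRing.residue O) h0
  simp only [map_sum, map_pow, h, one_pow, map_zero, Finset.sum_const, Finset.card_range,
    nsmul_eq_mul, mul_one] at h2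
  have h3 := CharP.cast_eq_zero (IsLocalRing.ResidueField O) (n + 1)
  rw [Nat.cast_succ, h2, zero_add] at h3
  exact one_ne_zero h3

/-- A residue field consisting of integers has no nontrivial automorphisms, so Galois acts
trivially on it. -/
theorem residue_algEquiv_eq (hO : ∀ (σ : K ≃ₐ[F] K), ∀ x ∈ O, σ x ∈ O)
    (hres : ∀ r : IsLocalRing.ResidueField O, ∃ m : ℕ, r = m) (σ : K ≃ₐ[F] K) (x : K)
    (hx : x ∈ O) :
    IsLocalRing.residue O ⟨σ x, hO σ x hx⟩ = IsLocalRing.residue O ⟨x, hx⟩ := by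
  obtain ⟨m, hm⟩ := hres (IsLocalRing.residue O ⟨x, hx⟩)
  rw [hm, ← sub_eq_zero, ← map_natCast (IsLocalRing.residue O), ← map_sub,
    IsLocalRing.residue_eq_zero_iff, IsLocalRing.mem_maximalIdeal, _root_.mem_nonunits_iff]
  rw [← sub_eq_zero, ← map_natCast (IsLocalRing.residue O), ← map_sub,
    IsLocalRing.residue_eq_zero_iff, IsLocalRing.mem_maximalIdeal, _root_.mem_nonunits_iff] at hm
  -- An inverse of `σ x - m` in `O` is carried by `σ⁻¹` to an inverse of `x - m` in `O`.
  intro hu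
  apply hm
  obtain ⟨w, hw⟩ := hu.exists_right_inv
  refine IsUnit.of_mul_eq_one ⟨σ.symm w, hO σ.symm w w.2⟩ (Subtype.ext ?_)
  apply σ.injective
  have := congrArg (Subtype.val) hw
  push_cast at this ⊢
  simpa using this

/-- In a Galois extension of degree `p - 1` with a Galois-stable valuation ring of residue field
`𝔽ₚ`, norms of units reduce to `(p - 1)`-th powers in `𝔽ₚˣ`, that is, to `1`. Hence `1` is the only
root of unity of order dividing `p - 1` which is a norm. -/
theorem eq_one_of_norm_eq [FiniteDimensional F K] [IsGalois F K]
    {n : ℕ} (hn : Module.finrank F K = n) [hp : Fact (n + 1).Prime]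
    [CharP (IsLocalRing.ResidueField O) (n + 1)]
    (hO : ∀ (σ : K ≃ₐ[F] K), ∀ x ∈ O, σ x ∈ O)
    (hres : ∀ r : IsLocalRing.ResidueField O, ∃ m : ℕ, r = m) {u : F} (hu : u ^ n = 1)
    {x : K} (hx : Algebra.norm F x = u) : u = 1 := by
  have hn0 : n ≠ 0 := by rintro rfl; exact Nat.not_prime_one hp.out
  -- On elements of `O` the norm reduces to the `n`-th power. One of `x`, `x⁻¹` is in `O`.
  have key : ∀ (v : F) (y : O), v ^ n = 1 → Algebra.norm F (y : K) = v →
      v = 1 := by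
    intro v y hv hy
    have hv' : (algebraMap F K v) ^ n = 1 := by rw [← map_pow, hv, map_one]
    have hmem : algebraMap F K v ∈ O := mem_of_pow_eq_one hn0 hv'
    set V : O := ⟨algebraMap F K v, hmem⟩ with hV
    have hVn : V ^ n = 1 := Subtype.ext hv'
    have hprod : V = ∏ σ : K ≃ₐ[F] K, (⟨σ y, hO σ y y.2⟩ : O) := by
      apply Subtype.ext
      push_cast
      rw [← Algebra.norm_eq_prod_automorphisms, hy]
    have h1 : IsLocalRing.residue O V = IsLocalRing.residue O y ^ n := by
      rw [hprod, map_prod, Finset.prod_congr rfl fun σ _ => residue_algEquiv_eq hO hres σ y y.2,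
        Finset.prod_const, Finset.card_univ, ← Nat.card_eq_fintype_card,
        IsGalois.card_aut_eq_finrank, hn]
    have h2 : IsLocalRing.residue O y ≠ 0 := by
      intro h0
      rw [h0, zero_pow hn0] at h1
      have h3 := congrArg (IsLocalRing.residue O) hVn
      rw [map_pow, h1, zero_pow hn0, map_one] at h3
      exact zero_ne_one h3
    have h3 : IsLocalRing.residue O y ^ n = 1 := by
      obtain ⟨m, hm⟩ := hres (IsLocalRing.residue O y)
      have h4 : IsLocalRing.residue O y ^ (n + 1) = IsLocalRing.residue O y := by
        rw [hm, ← frobenius_def, map_natCast]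
      rw [pow_succ] at h4
      exact mul_right_cancel₀ h2 (by rw [h4, one_mul])
    have h5 := eq_one_of_pow_eq_one_of_residue_eq_one hVn (h1.trans h3)
    exact (algebraMap F K).injective (by rw [map_one]; exact congrArg Subtype.val h5)
  rcases O.mem_or_inv_mem x with h | h
  · exact key u ⟨x, h⟩ hu hx
  · have := key u⁻¹ ⟨x⁻¹, h⟩ (by rw [inv_pow, hu, inv_one]) (by
      have hx0 : x ≠ 0 := by
        rintro rfl
        rw [Algebra.norm_zero] at hx
        rw [← hx, zero_pow hn0] at hu
        exact zero_ne_one hu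
      refine eq_inv_of_mul_eq_one_left ?_
      change Algebra.norm F x⁻¹ * u = 1
      rw [← hx, ← map_mul, inv_mul_cancel₀ hx0, map_one])
    rwa [inv_eq_one] at this

/-- If a valuation ring with residue field `𝔽ₚ` is stable under all automorphisms, a cyclic algebra
of degree `p - 1` whose structure constant is a primitive root of unity of order `p - 1` is a
division algebra. -/
theorem isDivisionAlgebra_cyclicAlgebra [FiniteDimensional F K] {σ : K ≃ₐ[F] K}
    {n : ℕ} (hn : orderOf σ = n) [hp : Fact (n + 1).Prime]
    [CharP (IsLocalRing.ResidueField O) (n + 1)]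
    (hO : ∀ (σ : K ≃ₐ[F] K), ∀ x ∈ O, σ x ∈ O)
    (hres : ∀ r : IsLocalRing.ResidueField O, ∃ m : ℕ, r = m) {u : F} (hu : IsPrimitiveRoot u n) :
    IsDivisionAlgebra (CyclicAlgebra σ u) := by
  have hn0 : n ≠ 0 := by rintro rfl; exact Nat.not_prime_one hp.out
  have hu' : IsPrimitiveRoot (algebraMap F K u) n :=
    hu.map_of_injective (algebraMap F K).injective
  have hmem : algebraMap F K u ∈ O := mem_of_pow_eq_one hn0 hu'.pow_eq_one
  set V : O := ⟨algebraMap F K u, hmem⟩ with hV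
  have hVn : IsPrimitiveRoot V n :=
    IsPrimitiveRoot.of_map_of_injective (f := O.subtype) hu' O.subtype_injective
  have hRn : IsPrimitiveRoot (IsLocalRing.residue O V) n := by
    refine ⟨by rw [← map_pow, hVn.pow_eq_one, map_one], fun l hl => ?_⟩
    refine hVn.dvd_of_pow_eq_one l (eq_one_of_pow_eq_one_of_residue_eq_one (n := n) ?_ ?_)
    · rw [← pow_mul, mul_comm, pow_mul, hVn.pow_eq_one, one_pow]
    · rw [map_pow, hl]
  let E := AlgebraicClosure (IsLocalRing.ResidueField O)
  let κ : IsLocalRing.ResidueField O →+* E := algebraMap _ _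
  let ρ : O →+* E := κ.comp (IsLocalRing.residue O)
  have hg : IsPrimitiveRoot (ρ V) n := hRn.map_of_injective κ.injective
  have : CharP E (n + 1) := charP_of_injective_algebraMap
    (algebraMap (IsLocalRing.ResidueField O) E).injective (n + 1)
  obtain ⟨α, hα⟩ := IsAlgClosed.exists_pow_nat_eq (ρ V) (Nat.pos_of_ne_zero hn0)
  refine CyclicAlgebra.isDivisionAlgebra_of_residue O (hO σ) hmem ρ
    (fun x hx => congrArg κ (residue_algEquiv_eq hO hres σ x hx)) (α := α)
    (by rw [hn, hα]) fun c hc i => ?_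
  subst hn
  refine eq_zero_of_sum_mul_pow_eq_zero hα hg (fun i => ?_) hc i
  obtain ⟨m, hm⟩ := hres (IsLocalRing.residue O (c i))
  change κ (IsLocalRing.residue O (c i)) ^ _ = κ (IsLocalRing.residue O (c i))
  rw [hm, map_natCast, ← frobenius_def, map_natCast]

end ValuationSubring

/-! ### The fields `F` and `K` -/

theorem jF_sq_add : jF ^ 2 + jF + 1 = 0 := by
  have h : IsPrimitiveRoot cubeRoot 3 := Complex.isPrimitiveRoot_exp 3 (by norm_num)
  have h1 := h.geom_sum_eq_zero (by norm_num)
  apply Subtype.ext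
  push_cast
  rw [coe_jF, ← h1]
  simp [Finset.sum_range_succ]
  ring

theorem theta_ne_zero : theta ≠ 0 := by
  rw [theta]
  have h : 0 < Real.cos (Real.pi / 14) :=
    Real.cos_pos_of_mem_Ioo ⟨by linarith [Real.pi_pos], by linarith [Real.pi_pos]⟩
  exact_mod_cast (mul_pos two_pos h).ne'

/-- With `z = e ^ (2πi/28)`, the polynomial at `θ = z + z⁻¹`, multiplied by `θ`, is
`z ^ 7 + z ^ (-7)`, which vanishes because `z ^ 14 = -1`. -/
theorem theta_root : theta ^ 6 - 7 * theta ^ 4 + 14 * theta ^ 2 - 7 = 0 := by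
  apply mul_left_cancel₀ theta_ne_zero
  set z := Complex.exp (2 * Real.pi * Complex.I / 28) with hz
  have hz0 : z ≠ 0 := Complex.exp_ne_zero _
  have h14 : z ^ 14 = -1 := by
    rw [hz, ← Complex.exp_nat_mul, ← Complex.exp_pi_mul_I]
    congr 1; push_cast; ring
  rw [theta_eq, ← hz]
  field_simp
  linear_combination h14

/-- `θ` as an element of `K`. -/
noncomputable def thetaK : ExtField := IntermediateField.AdjoinSimple.gen BaseField theta

theorem thetaK_root : thetaK ^ 6 - 7 * thetaK ^ 4 + 14 * thetaK ^ 2 - 7 = 0 := by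
  apply Subtype.ext
  exact theta_root

/-! ### The `7`-adic embedding -/

/-- An embedding of `K` into an algebraic closure of `ℚ_[7]` carries `F` into `ℚ_[7]`, since `7`
splits in `F`. -/
theorem exists_embedding : ∃ φ : ExtField →+* PadicAlgCl 7, ∀ c : BaseField, ∃ q : ℚ_[7],
    φ (algebraMap BaseField ExtField c) = algebraMap ℚ_[7] (PadicAlgCl 7) q := by
  obtain ⟨z, hz⟩ := exists_padic_root_cyclotomic_three
  have hint : IsIntegral ℚ cubeRoot := by
    refine ⟨Polynomial.X ^ 2 + Polynomial.X + 1, by monicity!, ?_⟩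
    have := congrArg (Subtype.val) jF_sq_add
    push_cast at this
    simpa [coe_jF] using this
  have : FiniteDimensional ℚ BaseField := IntermediateField.adjoin.finiteDimensional hint
  have : FiniteDimensional ℚ ExtField := FiniteDimensional.trans ℚ BaseField ExtField
  let φ : ExtField →+* PadicAlgCl 7 :=
    (IsAlgClosed.lift (R := ℚ) (S := ExtField) (M := PadicAlgCl 7)).toRingHom
  let ψ : BaseField →+* PadicAlgCl 7 := φ.comp (algebraMap BaseField ExtField)
  have hj : ∃ q : ℚ_[7], ψ jF = algebraMap ℚ_[7] (PadicAlgCl 7) q := by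
    have h1 : ψ jF ^ 2 + ψ jF + 1 = 0 := by
      rw [← map_pow, ← map_add, ← map_one ψ, ← map_add, jF_sq_add, map_zero]
    have h2 := congrArg (algebraMap ℚ_[7] (PadicAlgCl 7)) hz
    simp only [map_add, map_pow, map_one, map_zero] at h2
    have h3 : (ψ jF - algebraMap ℚ_[7] (PadicAlgCl 7) z) *
        (ψ jF - algebraMap ℚ_[7] (PadicAlgCl 7) (-1 - z)) = 0 := by
      simp only [map_sub, map_neg, map_one]
      linear_combination h1 - h2
    rcases mul_eq_zero.mp h3 with h | h
    · exact ⟨z, sub_eq_zero.mp h⟩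
    · exact ⟨-1 - z, sub_eq_zero.mp h⟩
  obtain ⟨q, hq⟩ := hj
  refine ⟨φ, fun c => ?_⟩
  obtain ⟨P, hP⟩ := (IntermediateField.adjoin.powerBasis hint).exists_eq_aeval' c
  have hgen : (IntermediateField.adjoin.powerBasis hint).gen = jF := rfl
  rw [hgen] at hP
  refine ⟨Polynomial.eval₂ (algebraMap ℚ ℚ_[7]) q P, ?_⟩
  change ψ c = _
  rw [hP, Polynomial.aeval_def, Polynomial.hom_eval₂, Polynomial.hom_eval₂, hq]
  congr 1
  exact Subsingleton.elim _ _

open Polynomial in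
/-- A monic polynomial of degree less than `6` cannot vanish at `θ`, because the norm of its value
in `PadicAlgCl 7` is at least that of its leading term. -/
theorem minpoly_thetaK :
    minpoly BaseField thetaK = X ^ 6 - 7 * X ^ 4 + 14 * X ^ 2 - 7 := by
  obtain ⟨φ, hφ⟩ := exists_embedding
  choose ι hι using hφ
  have hdeg : (X ^ 6 - 7 * X ^ 4 + 14 * X ^ 2 - 7 : BaseField[X]).degree = 6 := by
    compute_degree!
  refine (minpoly.unique _ _ (by monicity!) (by
    simpa [map_ofNat] using thetaK_root) fun q hq hq0 => ?_).symm
  rw [hdeg]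
  by_contra! hlt
  have hnat : q.natDegree < 6 := by
    rwa [natDegree_lt_iff_degree_lt hq.ne_zero]
  have hroot : φ thetaK ^ 6 - 7 * φ thetaK ^ 4 + 14 * φ thetaK ^ 2 - 7 = 0 := by
    simpa [map_ofNat] using congrArg φ thetaK_root
  have hsum : ∑ k ∈ Finset.range 6,
      algebraMap ℚ_[7] (PadicAlgCl 7) (ι (q.coeff k)) * φ thetaK ^ k = 0 := by
    rw [aeval_eq_sum_range' hnat] at hq0
    have := congrArg φ hq0
    simpa only [map_sum, map_zero, Algebra.smul_def, map_mul, map_pow, hι] using this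
  have h1 := norm_le_norm_sum_mul_pow (norm_pow_six_of_root hroot) (fun k => ι (q.coeff k)) hnat
  rw [hsum, norm_zero, coeff_natDegree, hq] at h1
  have h2 : algebraMap ℚ_[7] (PadicAlgCl 7) (ι 1) = 1 := by rw [← hι, map_one, map_one]
  have h3 : ι 1 = 1 := (algebraMap ℚ_[7] (PadicAlgCl 7)).injective (by rw [h2, map_one])
  have h4 : φ thetaK ≠ 0 := by
    rw [_root_.map_ne_zero]
    exact fun h => theta_ne_zero (congrArg Subtype.val h)
  rw [h3, norm_one, one_mul] at h1
  exact absurd h1 (not_le.mpr (by positivity))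

/-! ### The Galois group of `K / F` -/

theorem isIntegral_theta : IsIntegral BaseField theta := by
  refine ⟨Polynomial.X ^ 6 - 7 * Polynomial.X ^ 4 + 14 * Polynomial.X ^ 2 - 7, by monicity!, ?_⟩
  simpa using theta_root

theorem finrank_extField : Module.finrank BaseField ExtField = 6 := by
  rw [IntermediateField.adjoin.finrank isIntegral_theta]
  have h : minpoly BaseField theta = minpoly BaseField thetaK :=
    (minpoly.algebraMap_eq (algebraMap ExtField ℂ).injective thetaK)
  rw [h, minpoly_thetaK]
  compute_degree!

theorem exists_eq_sum_pow_thetaK (x : ExtField) : ∃ a : ℕ → BaseField,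
    x = ∑ k ∈ Finset.range 6, algebraMap BaseField ExtField (a k) * thetaK ^ k := by
  have hdim : (IntermediateField.adjoin.powerBasis isIntegral_theta).dim = 6 := by
    rw [← PowerBasis.finrank, finrank_extField]
  obtain ⟨P, hP, hx⟩ := (IntermediateField.adjoin.powerBasis isIntegral_theta).exists_eq_aeval x
  have hgen : (IntermediateField.adjoin.powerBasis isIntegral_theta).gen = thetaK := rfl
  rw [hgen, Polynomial.aeval_eq_sum_range' (hP.trans_eq hdim)] at hx
  exact ⟨P.coeff, by simpa only [Algebra.smul_def] using hx⟩

/-- The element `θ ^ 3 - 3 θ` is the conjugate `2 cos (3π/14)` of `θ`. -/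
theorem thetaK_cubic_sq : (thetaK ^ 3 - 3 * thetaK) ^ 2 = thetaK ^ 4 - 5 * thetaK ^ 2 + 7 := by
  linear_combination thetaK_root

/-- The element `θ ^ 5 - 5 θ ^ 3 + 5 θ` is the conjugate `2 cos (5π/14)` of `θ`. -/
theorem thetaK_quintic_sq :
    (thetaK ^ 5 - 5 * thetaK ^ 3 + 5 * thetaK) ^ 2 = 4 * thetaK ^ 2 - thetaK ^ 4 := by
  linear_combination (thetaK ^ 4 - 3 * thetaK ^ 2) * thetaK_root

open Polynomial in
theorem splits_minpoly_thetaK :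
    ((minpoly BaseField thetaK).map (algebraMap BaseField ExtField)).Splits := by
  have h : (minpoly BaseField thetaK).map (algebraMap BaseField ExtField) =
      (X - C thetaK) * (X - C (-thetaK)) *
      (X - C (thetaK ^ 3 - 3 * thetaK)) * (X - C (-(thetaK ^ 3 - 3 * thetaK))) *
      (X - C (thetaK ^ 5 - 5 * thetaK ^ 3 + 5 * thetaK)) *
      (X - C (-(thetaK ^ 5 - 5 * thetaK ^ 3 + 5 * thetaK))) := by
    have hθ := congrArg C thetaK_root
    have hc := congrArg C thetaK_cubic_sq
    have hb := congrArg C thetaK_quintic_sq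
    rw [minpoly_thetaK]
    simp only [map_sub, map_add, map_mul, map_pow, map_neg, map_ofNat, map_zero, Polynomial.map_sub,
      Polynomial.map_add, Polynomial.map_mul, Polynomial.map_pow, Polynomial.map_ofNat,
      Polynomial.map_X] at hθ hc hb ⊢
    set t : ExtField[X] := C thetaK
    calc X ^ 6 - 7 * X ^ 4 + 14 * X ^ 2 - 7
        = (X ^ 2 - t ^ 2) * (X ^ 2 - (t ^ 4 - 5 * t ^ 2 + 7)) * (X ^ 2 - (4 * t ^ 2 - t ^ 4)) := by
          linear_combination (-X ^ 2 * (2 - t ^ 2) + (1 + 2 * t ^ 2 - t ^ 4)) * hθ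
      _ = (X ^ 2 - t ^ 2) * (X ^ 2 - (t ^ 3 - 3 * t) ^ 2) *
            (X ^ 2 - (t ^ 5 - 5 * t ^ 3 + 5 * t) ^ 2) := by rw [hc, hb]
      _ = _ := by ring
  rw [h]
  repeat' apply Splits.mul
  all_goals exact Splits.X_sub_C _

theorem isGalois_extField : IsGalois BaseField ExtField := by
  have hadj : Algebra.adjoin BaseField ({thetaK} : Set ExtField) = ⊤ :=
    (IntermediateField.adjoin.powerBasis isIntegral_theta).adjoin_gen_eq_top
  have hint : IsIntegral BaseField thetaK := Algebra.IsIntegral.isIntegral _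
  have : (minpoly BaseField thetaK).IsSplittingField BaseField ExtField := by
    refine ⟨splits_minpoly_thetaK, top_le_iff.mp ?_⟩
    rw [← hadj]
    refine Algebra.adjoin_mono (Set.singleton_subset_iff.mpr ?_)
    rw [Polynomial.mem_rootSet]
    exact ⟨minpoly.ne_zero hint, minpoly.aeval _ _⟩
  exact IsGalois.of_separable_splitting_field (p := minpoly BaseField thetaK)
    (minpoly.irreducible hint).separable

/-- The automorphism `2 cos (π/14) ↦ 2 cos (5π/14)` has order `6`: its square and its cube send `θ`
to `2 cos (25π/14) = 2 cos (3π/14)` and to `2 cos (15π/14) = -θ`. -/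
theorem exists_algEquiv_orderOf_eq_six : ∃ τ : Gal(ExtField/BaseField), orderOf τ = 6 := by
  have := isGalois_extField
  have h0 : thetaK ≠ 0 := fun h => theta_ne_zero (congrArg Subtype.val h)
  obtain ⟨τ, hτ⟩ : ∃ τ : Gal(ExtField/BaseField),
      τ thetaK = thetaK ^ 5 - 5 * thetaK ^ 3 + 5 * thetaK := by
    refine minpoly.exists_algEquiv_of_root' (Algebra.IsAlgebraic.isAlgebraic _) ?_
    rw [minpoly_thetaK]
    simp only [map_sub, map_add, map_mul, map_pow, map_ofNat, Polynomial.aeval_X]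
    rw [show ∀ b : ExtField, b ^ 6 - 7 * b ^ 4 + 14 * b ^ 2 - 7 =
      (b ^ 2) ^ 3 - 7 * (b ^ 2) ^ 2 + 14 * b ^ 2 - 7 from fun b => by ring, thetaK_quintic_sq]
    linear_combination (1 - 6 * thetaK ^ 2 + 5 * thetaK ^ 4 - thetaK ^ 6) * thetaK_root
  have hquintic : ∀ b : ExtField, b ^ 5 - 5 * b ^ 3 + 5 * b =
      b * ((b ^ 2) ^ 2 - 5 * b ^ 2 + 5) := fun b => by ring
  have hτ2 : τ (τ thetaK) = thetaK ^ 3 - 3 * thetaK := by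
    conv_lhs => rw [hτ]
    simp only [map_sub, map_add, map_mul, map_pow, map_ofNat]
    rw [hτ, hquintic, thetaK_quintic_sq]
    linear_combination
      thetaK * (-4 + 10 * thetaK ^ 2 - 6 * thetaK ^ 4 + thetaK ^ 6) * thetaK_root
  have hτ3 : τ (τ (τ thetaK)) = -thetaK := by
    rw [hτ]
    simp only [map_sub, map_add, map_mul, map_pow, map_ofNat]
    rw [hτ2, hquintic, thetaK_cubic_sq]
    linear_combination thetaK * (8 - 6 * thetaK ^ 2 + thetaK ^ 4) * thetaK_root
  refine ⟨τ, orderOf_eq_of_pow_and_pow_div_prime (by norm_num) ?_ fun p hp hdvd => ?_⟩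
  · rw [← finrank_extField, ← IsGalois.card_aut_eq_finrank, pow_card_eq_one']
  have hp6 : p ≤ 6 := Nat.le_of_dvd (by norm_num) hdvd
  have h23 : p = 2 ∨ p = 3 := by
    interval_cases p <;> first | omega | (exfalso; revert hp; norm_num)
  rcases h23 with rfl | rfl <;> intro h
  · have h1 : (τ ^ 3) thetaK = thetaK := by rw [show τ ^ 3 = 1 from h]; rfl
    rw [pow_succ, pow_two] at h1
    have h2 : -thetaK = thetaK := hτ3.symm.trans h1
    exact h0 (by linear_combination (-1 / 2 : ExtField) * h2)
  · have h1 : (τ ^ 2) thetaK = thetaK := by rw [show τ ^ 2 = 1 from h]; rfl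
    rw [pow_two] at h1
    have h2 : thetaK ^ 3 - 3 * thetaK = thetaK := hτ2.symm.trans h1
    have h3 : thetaK ^ 2 - 4 = 0 := mul_left_cancel₀ h0 (by linear_combination h2)
    -- Modulo `θ ^ 2 - 4` the minimal polynomial of `θ` is `1`.
    exact one_ne_zero (α := ExtField)
      (by linear_combination thetaK_root - (thetaK ^ 4 - 3 * thetaK ^ 2 + 2) * h3)

theorem isCyclic_gal : IsCyclic Gal(ExtField/BaseField) := by
  have := isGalois_extField
  obtain ⟨τ, hτ⟩ := exists_algEquiv_orderOf_eq_six
  exact isCyclic_of_orderOf_eq_card τ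
    (by rw [hτ, IsGalois.card_aut_eq_finrank, finrank_extField])

theorem orderOf_eq_six_of_forall_mem_zpowers {σ : Gal(ExtField/BaseField)}
    (hσ : ∀ τ, τ ∈ Subgroup.zpowers σ) : orderOf σ = 6 := by
  have := isGalois_extField
  rw [orderOf_eq_card_of_forall_mem_zpowers hσ, IsGalois.card_aut_eq_finrank, finrank_extField]

/-! ### The `7`-adic valuation ring of `K` -/

/-- The valuation ring of `K` for a `7`-adic norm is stable under the Galois group and has residue
field `𝔽₇`, since integrality and residue of `∑ k < 6, a k * b ^ k`, for any conjugate `b` of `θ`,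
can be read off from the coefficients `a k ∈ ℚ_[7]`. -/
theorem exists_valuationSubring : ∃ O : ValuationSubring ExtField,
    (∀ σ : Gal(ExtField/BaseField), ∀ x ∈ O, σ x ∈ O) ∧
    CharP (IsLocalRing.ResidueField O) 7 ∧
    ∀ r : IsLocalRing.ResidueField O, ∃ m : ℕ, r = m := by
  obtain ⟨φ, hφ⟩ := exists_embedding
  choose ι hι using hφ
  let O : ValuationSubring ExtField :=
    (NormedField.valuation (K := PadicAlgCl 7)).valuationSubring.comap φ
  have hmem : ∀ x, x ∈ O ↔ ‖φ x‖ ≤ 1 := fun _ => Iff.rfl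
  have hroot : ∀ b : ExtField, b ^ 6 - 7 * b ^ 4 + 14 * b ^ 2 - 7 = 0 →
      ‖φ b‖ ^ 6 = ((7 : ℕ) : ℝ)⁻¹ := fun b hb =>
    norm_pow_six_of_root (by simpa [map_ofNat] using congrArg φ hb)
  have hsum : ∀ (a : ℕ → BaseField) (b : ExtField),
      φ (∑ k ∈ Finset.range 6, algebraMap BaseField ExtField (a k) * b ^ k) =
        ∑ k ∈ Finset.range 6, algebraMap ℚ_[7] (PadicAlgCl 7) (ι (a k)) * φ b ^ k := by
    intro a b
    simp only [map_sum, map_mul, map_pow, hι]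
  have hint : ∀ (a : ℕ → BaseField) (b : ExtField), b ^ 6 - 7 * b ^ 4 + 14 * b ^ 2 - 7 = 0 →
      (∑ k ∈ Finset.range 6, algebraMap BaseField ExtField (a k) * b ^ k ∈ O ↔
        ∀ k < 6, ‖ι (a k)‖ ≤ 1) := fun a b hb => by
    rw [hmem, hsum, norm_sum_mul_pow_le_one_iff (hroot b hb)]
  have hres : ∀ x : O, ‖φ x‖ < 1 → IsLocalRing.residue O x = 0 := by
    intro x hx
    rw [IsLocalRing.residue_eq_zero_iff, IsLocalRing.mem_maximalIdeal, mem_nonunits_iff]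
    intro hu
    obtain ⟨w, hw⟩ := hu.exists_right_inv
    have h1 : φ x * φ w = 1 := by
      rw [← map_mul, ← map_one φ]
      exact congrArg φ (congrArg Subtype.val hw)
    have h2 := congrArg norm h1
    rw [norm_mul, norm_one] at h2
    have h3 : ‖φ w‖ ≤ 1 := w.2
    nlinarith [norm_nonneg (φ x)]
  refine ⟨O, fun σ x hx => ?_, ?_, fun r => ?_⟩
  · obtain ⟨a, rfl⟩ := exists_eq_sum_pow_thetaK x
    rw [hint a thetaK thetaK_root] at hx
    simp only [map_sum, map_mul, map_pow, AlgEquiv.commutes]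
    exact (hint a (σ thetaK) (by simpa [map_ofNat] using congrArg σ thetaK_root)).mpr hx
  · rw [CharP.charP_iff_prime_eq_zero (by norm_num), ← map_natCast (IsLocalRing.residue O)]
    refine hres _ ?_
    have h7 : φ ((7 : ℕ) : O) = algebraMap ℚ_[7] (PadicAlgCl 7) (7 : ℕ) := by
      rw [map_natCast, ← map_natCast φ]
      exact congrArg φ (map_natCast O.subtype 7)
    rw [h7, norm_algebraMap']
    exact Padic.norm_p_lt_one
  · obtain ⟨x, rfl⟩ := IsLocalRing.residue_surjective r
    obtain ⟨a, ha⟩ := exists_eq_sum_pow_thetaK x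
    have hx : (x : ExtField) ∈ O := x.2
    rw [ha, hint a thetaK thetaK_root] at hx
    obtain ⟨w, hw⟩ : ∃ w : ℤ_[7], (w : ℚ_[7]) = ι (a 0) := ⟨⟨ι (a 0), hx 0 (by norm_num)⟩, rfl⟩
    obtain ⟨m, -, hm⟩ := w.exists_mem_range
    refine ⟨m, ?_⟩
    rw [← sub_eq_zero, ← map_natCast (IsLocalRing.residue O), ← map_sub]
    refine hres _ ?_
    have hsplit : φ ((x - (m : O) : O) : ExtField) =
        ∑ k ∈ Finset.range 5, algebraMap ℚ_[7] (PadicAlgCl 7) (ι (a (k + 1))) *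
          φ thetaK ^ (k + 1) + algebraMap ℚ_[7] (PadicAlgCl 7) (ι (a 0) - m) := by
      have hcoe : ((x - (m : O) : O) : ExtField) = x - (m : ExtField) :=
        (map_sub O.subtype _ _).trans (congrArg _ (map_natCast O.subtype m))
      rw [hcoe, map_sub φ, ha, hsum, Finset.sum_range_succ', pow_zero, mul_one, map_natCast φ,
        map_sub (algebraMap ℚ_[7] (PadicAlgCl 7)), map_natCast (algebraMap ℚ_[7] (PadicAlgCl 7)),
        add_sub_assoc]
    have hθ : ‖φ thetaK‖ < 1 := by
      refine lt_of_not_ge fun h => ?_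
      have h1 := one_le_pow₀ h (n := 6)
      rw [hroot thetaK thetaK_root] at h1
      norm_num at h1
    rw [hsplit]
    refine (IsUltrametricDist.norm_add_le_max _ _).trans_lt (max_lt ?_ ?_)
    · refine lt_of_le_of_lt (IsUltrametricDist.norm_sum_le_of_forall_le_of_nonneg
        (norm_nonneg (φ thetaK)) fun k hk => ?_) hθ
      rw [norm_mul, norm_algebraMap', norm_pow, pow_succ, ← mul_assoc]
      refine mul_le_of_le_one_left (norm_nonneg _) ?_
      exact mul_le_one₀ (hx (k + 1) (by have := Finset.mem_range.mp hk; omega)) (by positivity)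
        (pow_le_one₀ (norm_nonneg _) hθ.le)
    · rw [norm_algebraMap']
      rw [IsLocalRing.mem_maximalIdeal, PadicInt.mem_nonunits, PadicInt.norm_def,
        PadicInt.coe_sub, PadicInt.coe_natCast, hw] at hm
      exact hm

theorem mainTheorem4 :
    IsGalois BaseField ExtField ∧
    IsCyclic Gal(ExtField/BaseField) ∧
    Module.finrank BaseField ExtField = 6 ∧
    (∀ u ∈ ({jF, -jF, jF ^ 2, -jF ^ 2, -1} : Set BaseField),
      ¬ ∃ x : ExtField, Algebra.norm BaseField x = u) ∧
    ∀ σ : Gal(ExtField/BaseField), (∀ τ, τ ∈ Subgroup.zpowers σ) →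
      IsDivisionAlgebra (CyclicAlgebra σ (-jF)) := by
  have := isGalois_extField
  obtain ⟨O, hO, hchar, hres⟩ := exists_valuationSubring
  have hprime : Fact (Nat.Prime (6 + 1)) := fact_prime_seven
  have hj3 : jF ^ 3 = 1 := by linear_combination (jF - 1) * jF_sq_add
  have hj1 : jF ≠ 1 := by
    intro h
    have h1 := jF_sq_add
    rw [h] at h1
    norm_num at h1
  have hj2 : jF ^ 2 ≠ 1 := fun h => hj1 (by linear_combination hj3 - jF * h)
  have hneg : (-1 : BaseField) ≠ 1 := by norm_num
  have hprim : IsPrimitiveRoot (-jF) 6 := by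
    refine IsPrimitiveRoot.mk_of_lt _ (by norm_num) (by linear_combination (jF ^ 3 + 1) * hj3)
      fun l hl hl6 h => ?_
    have h3 : (-1 : BaseField) ^ l = 1 := by
      rw [show (-1 : BaseField) = (-jF) ^ 3 by linear_combination hj3, ← pow_mul, mul_comm,
        pow_mul, h, one_pow]
    interval_cases l
    · exact hneg (by simpa using h3)
    · exact hj2 (by linear_combination h)
    · exact hneg (by linear_combination h3)
    · exact hj1 (by linear_combination h - jF * hj3)
    · exact hneg (by linear_combination h3)
  refine ⟨this, isCyclic_gal, finrank_extField, ?_, fun σ hσ =>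
    ValuationSubring.isDivisionAlgebra_cyclicAlgebra (O := O)
      (orderOf_eq_six_of_forall_mem_zpowers hσ) hO hres hprim⟩
  rintro u hu ⟨x, hx⟩
  have hu6 : u ^ 6 = 1 := by
    rcases hu with rfl | rfl | rfl | rfl | rfl
    · linear_combination (jF ^ 3 + 1) * hj3
    · linear_combination (jF ^ 3 + 1) * hj3
    · linear_combination (jF ^ 9 + jF ^ 6 + jF ^ 3 + 1) * hj3
    · linear_combination (jF ^ 9 + jF ^ 6 + jF ^ 3 + 1) * hj3
    · norm_num
  have hu1 : u = 1 := ValuationSubring.eq_one_of_norm_eq finrank_extField hO hres hu6 hx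
  rcases hu with rfl | rfl | rfl | rfl | rfl
  · exact hj1 hu1
  · exact hneg (by linear_combination congrArg (· ^ 3) hu1 + hj3)
  · exact hj2 hu1
  · exact hneg (by linear_combination congrArg (· ^ 3) hu1 + (jF ^ 3 + 1) * hj3)
  · exact hneg hu1
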